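/- Consider the join-the-shortest-queue (JSQ) system with $n\ge 1$ servers and abandonment: jobs arrive according to a Poisson process of rate $\lambda>0$ and join the shortest queue (ties are broken in favour of the smallest index), server $i$ serves at exponential rate $\mu_i>0$, and every job present (including jobs in service) abandons at rate $\gamma>0$. Thus the vector of queue lengths is the continuous-time Markov chain on $\mathbb{N}^n$ (where $\mathbb N=\{0,1,2,\dots\}$) with jump rates $$Q(x,x+e_*)=\lambda,\qquad Q(x,x-e_i)=\mu_i+\gamma x_i\ \text{ if } x_i\ge 1,\qquad Q(x,x')=0\ \text{ otherwise},$$ where $e_i$ is the $i$-th unit vector and $e_*$ is the unit vector of the smallest index attaining $\min_i x_i$. Put $\mu=\sum_{i=1}^n\mu_i$ and assume that the system is overloaded, $\lambda>\mu$. Let $\mathbf q$ be a random vector distributed according to the stationary distribution of this chain (a probability distribution $\pi$ with $\pi Q=0$, i.e. $\pi(x)\sum_{y}Q(x,y)=\sum_y\pi(y)Q(y,x)$ for all $x$), and let $$\tilde{\mathbf q}=\frac{n\sqrt\gamma}{\sqrt\lambda}\Big(\mathbf q-\frac{\lambda-\mu}{n\gamma}\mathbf 1\Big),$$ where $\mathbf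 1$ is the all-ones vector. Let $\phi\in\mathbb{R}^n$ with Euclidean norm $\|\phi\|=1$ and $\phi\ge 0$ coordinatewise. Then for every $a\ge e^2n\sqrt\lambda/\sqrt\gamma$, $$\mathbb P\big(\langle\tilde{\mathbf q},\phi\rangle>a\big)\le\exp\left(-\left(\frac{a\sqrt\lambda}{2n\sqrt\gamma\,\langle\phi,\mathbf 1\rangle}+\frac{\lambda-\mu}{n\gamma}\right)\log\left(\frac{a\sqrt\gamma}{n\sqrt\lambda\,\langle\phi,\mathbf 1\rangle}+\frac{\lambda-\mu}{n\lambda}\right)\right).$$ -/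

import Mathlib

open MeasureTheory
open scoped ENNReal

noncomputable section

/-- The server joined by an arriving job under join-the-shortest-queue: among the shortest queues,
the one with the smallest index. -/
def jsqTarget {n : ℕ} [NeZero n] (x : Fin n → ℕ) : Fin n :=
  (Finset.univ.filter fun i => ∀ j, x i ≤ x j).min'
    (by
      obtain ⟨i, hi⟩ := Finite.exists_min x
      exact ⟨i, by simpa using hi⟩)

/-- The transition rate kernel `Q(x, x')` of the join-the-shortest-queue system with abandonment:
arrivals at total rate `lam`, service rate `μ i` at server `i`, and abandonment rate `γ` of each
job present (including jobs in service). The condition `x = x' + e_i` says `x' = x - e_i ≥ 0`. -/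
def jsqRate {n : ℕ} [NeZero n] (lam γ : ℝ) (μ : Fin n → ℝ) (x x' : Fin n → ℕ) : ℝ :=
  if x' = x + Pi.single (jsqTarget x) 1 then lam
  else ∑ i, if x = x' + Pi.single i 1 then μ i + γ * (x i : ℝ) else 0

/-- `π` is a stationary distribution of the continuous-time Markov chain on `S` whose jump rate
from `x` to `y` is `Q x y ≥ 0` (with `Q x x = 0`): `π` is a probability measure with `π Q = 0`,
that is, for every state the stationary probability flow out of it equals the flow into it. -/
structure IsStationaryDistribution {S : Type*} [MeasurableSpace S]
    (Q : S → S → ℝ) (π : Measure S) : Prop where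
  isProbabilityMeasure : IsProbabilityMeasure π
  balance : ∀ x : S,
    ∑' y : S, π {x} * ENNReal.ofReal (Q x y) = ∑' y : S, π {y} * ENNReal.ofReal (Q y x)

/-- The all-ones vector. -/
def onesVec (n : ℕ) : EuclideanSpace ℝ (Fin n) := WithLp.toLp 2 fun _ => 1

/-- The centered and normalized queue length vector
`n √γ / √lam • (x - (lam - ∑ μ i) / (n γ) • 1)`. -/
def normalizedQueue {n : ℕ} (lam γ : ℝ) (μ : Fin n → ℝ) (x : Fin n → ℕ) :
    EuclideanSpace ℝ (Fin n) :=
  ((n : ℝ) * √γ / √lam) •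
    ((WithLp.toLp 2 fun i => (x i : ℝ)) - ((lam - ∑ i, μ i) / ((n : ℝ) * γ)) • onesVec n)

end

/-! Only the total queue length `N` matters, so the routing rule plays no role. Across the cut
between `N ≤ k` and `N = k + 1`, the upward flow has rate `lam` and the downward flow has rate at
least `γ * (k + 1)`, abandonments alone. So the level probabilities decay at least as fast as
Poisson weights of mean `r = lam / γ` (`jsq_level_ratio`). This bounds the factorial moments, then
the generating function (`tsum_mul_one_add_pow_le`), and yields the Poisson Chernoff bound
(`jsq_total_tail`). Since `0 ≤ φ i ≤ 1`, the projection of the queue vector on `φ` is at most `N`,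
and the event forces `N > s * (b + c)`, with `s` the coordinate sum of `φ` and `b`, `c` the two
terms of the centred threshold. The lower bound on `a` lets the Chernoff exponent dominate the
claimed one (`chernoff_exponent_ge`). -/

/-! ### Stationary flow across a level of the total queue length -/

/-- Global balance over a finite set `A`: the stationary flow out of `A` equals the flow into
it. -/
lemma IsStationaryDistribution.flow_eq {S : Type*} [DecidableEq S] [MeasurableSpace S]
    {Q : S → S → ℝ} {π : Measure S} (h : IsStationaryDistribution Q π) (A : Finset S) :
    ∑ x ∈ A, ∑' y, (if y ∈ A then 0 else π {x} * ENNReal.ofReal (Q x y)) =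
      ∑ x ∈ A, ∑' y, (if y ∈ A then 0 else π {y} * ENNReal.ofReal (Q y x)) := by
  have := h.isProbabilityMeasure
  have split : ∀ f : S → ℝ≥0∞,
      ∑' y, f y = ∑ y ∈ A, f y + ∑' y, (if y ∈ A then 0 else f y) := by
    intro f
    have h1 : ∑ y ∈ A, f y = ∑' y, (if y ∈ A then f y else 0) := by
      rw [tsum_eq_sum (s := A) (fun y hy => if_neg hy)]
      exact Finset.sum_congr rfl fun y hy => (if_pos hy).symm
    rw [h1, ← ENNReal.tsum_add]
    refine tsum_congr fun y => ?_
    split_ifs <;> simp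
  have key := Finset.sum_congr (rfl : A = A) fun x _ =>
    (split _).symm.trans ((h.balance x).trans (split _))
  simp only [Finset.sum_add_distrib] at key
  -- The flow inside `A` is the same on both sides. It cancels because it is finite, `A` being
  -- finite.
  rw [Finset.sum_comm (s := A) (t := A) (f := fun x y => π {x} * ENNReal.ofReal (Q x y))] at key
  refine (ENNReal.add_right_inj ?_).1 key
  exact ENNReal.sum_ne_top.2 fun x _ => ENNReal.sum_ne_top.2 fun y _ =>
    ENNReal.mul_ne_top (measure_ne_top _ _) ENNReal.ofReal_ne_top

/-- Out of a state with total `k ≤ K`, the chain leaves `{total ≤ K}` only by an arrival, and only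
if `k = K`. -/
lemma tsum_jsqRate_exit_le {n : ℕ} [NeZero n] (lam γ : ℝ) (μ : Fin n → ℝ) (k : ℕ)
    (x : Fin n → ℕ) (hx : ∑ i, x i ≤ k) (p : ℝ≥0∞) :
    ∑' y : Fin n → ℕ, (if ∑ i, y i ≤ k then 0 else p * ENNReal.ofReal (jsqRate lam γ μ x y)) ≤
      if ∑ i, x i = k then p * ENNReal.ofReal lam else 0 := by
  -- The bound becomes a sum supported on the arrival target, so the comparison is termwise.
  rw [← tsum_ite_eq (x + Pi.single (jsqTarget x) 1)
    (fun _ => if ∑ i, x i = k then p * ENNReal.ofReal lam else 0)]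
  refine ENNReal.tsum_le_tsum fun y => ?_
  by_cases hy : ∑ i, y i ≤ k
  · simp [hy]
  rw [if_neg hy]
  by_cases hxy : y = x + Pi.single (jsqTarget x) 1
  · have hsum : ∑ i, y i = ∑ i, x i + 1 := by
      rw [hxy]; simp [Finset.sum_add_distrib]
    rw [if_pos hxy, if_pos (by omega), jsqRate, if_pos hxy]
  · rw [jsqRate, if_neg hxy, if_neg hxy, Finset.sum_eq_zero]
    · simp
    · intro i _
      rw [if_neg]
      intro h
      have : ∑ i, x i = ∑ i, y i + 1 := by
        rw [h]; simp [Finset.sum_add_distrib]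
      omega

/-- The rate at which a state with total `k + 1` enters `{total ≤ k}` is at least
`γ * (k + 1)`. -/
lemma le_sum_jsqRate_enter {n : ℕ} [NeZero n] (lam γ : ℝ) (μ : Fin n → ℝ) (hγ : 0 < γ)
    (hμ : ∀ i, 0 < μ i) (k : ℕ) (y : Fin n → ℕ) (hy : ∑ i, y i = k + 1)
    (A : Finset (Fin n → ℕ)) (hA : ∀ x, x ∈ A ↔ ∑ i, x i ≤ k) :
    ENNReal.ofReal (γ * (k + 1)) ≤ ∑ x ∈ A, ENNReal.ofReal (jsqRate lam γ μ y x) := by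
  have hrate : ∀ x ∈ A, jsqRate lam γ μ y x =
      ∑ i, if y = x + Pi.single i 1 then μ i + γ * (y i : ℝ) else 0 := by
    intro x hx
    rw [jsqRate, if_neg]
    intro h
    have : ∑ i, x i = ∑ i, y i + 1 := by
      rw [h]; simp [Finset.sum_add_distrib]
    have := (hA x).1 hx
    omega
  have hterm : ∀ (x : Fin n → ℕ) (i : Fin n),
      0 ≤ if y = x + Pi.single i 1 then μ i + γ * (y i : ℝ) else 0 := by
    intro x i
    have := hμ i
    split_ifs <;> positivity
  rw [← ENNReal.ofReal_sum_of_nonneg]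
  swap
  · intro x hx
    rw [hrate x hx]
    exact Finset.sum_nonneg fun i _ => hterm x i
  refine ENNReal.ofReal_le_ofReal ?_
  rw [Finset.sum_congr rfl hrate, Finset.sum_comm]
  have hy' : (k + 1 : ℝ) = ∑ i, (y i : ℝ) := by exact_mod_cast hy.symm
  rw [hy', Finset.mul_sum]
  refine Finset.sum_le_sum fun i _ => ?_
  rcases Nat.eq_zero_or_pos (y i) with h0 | hpos
  · rw [h0]
    simpa [h0] using Finset.sum_nonneg fun x (_ : x ∈ A) => hterm x i
  -- Truncated subtraction is exact here since `y i ≥ 1`; this single target already carries server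
  -- `i`'s share `γ * y i`.
  · have hyi : y = (y - Pi.single i 1) + Pi.single i 1 := by
      funext j
      by_cases hj : j = i
      · subst hj; simp; omega
      · simp [hj]
    have hmem : y - Pi.single i 1 ∈ A := by
      have : ∑ j, y j = ∑ j, (y - Pi.single i 1 : Fin n → ℕ) j + 1 := by
        conv_lhs => rw [hyi]
        simp only [Pi.add_apply, Finset.sum_add_distrib, Finset.sum_pi_single', Finset.mem_univ,
          if_true]
      rw [hA]
      omega
    refine le_trans ?_ (Finset.single_le_sum (fun x _ => hterm x i) hmem)
    rw [if_pos hyi]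
    linarith [hμ i]

/-- The stationary total queue length has at most the level-to-level ratios of a Poisson
distribution with mean `lam / γ`. -/
lemma jsq_level_ratio {n : ℕ} [NeZero n] (lam γ : ℝ) (μ : Fin n → ℝ) (hγ : 0 < γ)
    (hμ : ∀ i, 0 < μ i) {π : Measure (Fin n → ℕ)}
    (h : IsStationaryDistribution (jsqRate lam γ μ) π) (k : ℕ) :
    ENNReal.ofReal (γ * (k + 1)) * π {x | ∑ i, x i = k + 1} ≤
      ENNReal.ofReal lam * π {x | ∑ i, x i = k} := by
  have hfin : ∀ k : ℕ, {x : Fin n → ℕ | ∑ i, x i ≤ k}.Finite := fun k =>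
    (Set.finite_Iic (fun _ : Fin n => k)).subset fun x hx i =>
      (Finset.single_le_sum (fun j _ => Nat.zero_le (x j)) (Finset.mem_univ i)).trans hx
  set A := (hfin k).toFinset with hAdef
  have hA : ∀ x, x ∈ A ↔ ∑ i, x i ≤ k := fun x => by simp [hAdef]
  have hlevel : ∀ k : ℕ, π {x | ∑ i, x i = k} =
      ∑ x ∈ (Finset.univ : Finset (Fin n)).piAntidiag k, π {x} := by
    intro k
    rw [sum_measure_singleton]
    congr 1
    ext x
    simp
  have hflow := h.flow_eq A
  calc
    _ = ∑ y ∈ (Finset.univ : Finset (Fin n)).piAntidiag (k + 1),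
          π {y} * ENNReal.ofReal (γ * (k + 1)) := by
        rw [hlevel, Finset.mul_sum]
        exact Finset.sum_congr rfl fun _ _ => mul_comm _ _
    _ ≤ ∑ y ∈ (Finset.univ : Finset (Fin n)).piAntidiag (k + 1),
          ∑ x ∈ A, (if y ∈ A then 0 else π {y} * ENNReal.ofReal (jsqRate lam γ μ y x)) := by
        refine Finset.sum_le_sum fun y hy => ?_
        have hy' : ∑ i, y i = k + 1 := by simpa using hy
        have hyA : y ∉ A := by rw [hA]; omega
        simp only [if_neg hyA]
        rw [← Finset.mul_sum]
        gcongr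
        exact le_sum_jsqRate_enter lam γ μ hγ hμ k y hy' A hA
    _ ≤ ∑ x ∈ A, ∑' y,
          (if y ∈ A then 0 else π {y} * ENNReal.ofReal (jsqRate lam γ μ y x)) := by
        rw [Finset.sum_comm]
        exact Finset.sum_le_sum fun x _ => ENNReal.sum_le_tsum _
    _ = ∑ x ∈ A, ∑' y,
          (if y ∈ A then 0 else π {x} * ENNReal.ofReal (jsqRate lam γ μ x y)) := hflow.symm
    _ ≤ ∑ x ∈ A, (if ∑ i, x i = k then π {x} * ENNReal.ofReal lam else 0) := by
        refine Finset.sum_le_sum fun x hx => ?_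
        simp only [hA]
        exact tsum_jsqRate_exit_le lam γ μ k x ((hA x).1 hx) _
    _ = _ := by
        rw [hlevel, Finset.mul_sum, ← Finset.sum_filter]
        refine Finset.sum_congr ?_ fun _ _ => mul_comm _ _
        ext x
        simp only [Finset.mem_filter, hA, Finset.mem_piAntidiag, Finset.mem_univ, implies_true,
          and_true]
        exact ⟨fun h => h.2, fun h => ⟨h.le, h⟩⟩

/-! ### Poisson moment and tail bounds from a ratio condition -/

/-- Factorial moments of a sequence with at most the ratios of a Poisson distribution. -/
lemma tsum_mul_choose_le {p : ℕ → ℝ≥0∞} {r : ℝ≥0∞} (hsum : ∑' k, p k ≤ 1)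
    (hp : ∀ k : ℕ, ((k + 1 : ℕ) : ℝ≥0∞) * p (k + 1) ≤ r * p k) (j : ℕ) :
    (j.factorial : ℝ≥0∞) * ∑' k, p k * (k.choose j : ℝ≥0∞) ≤ r ^ j := by
  induction j with
  | zero => simpa using hsum
  | succ j ih =>
    -- The term `k = 0` vanishes. After the shift, `(j + 1) * choose (k + 1) (j + 1) = (k + 1) *
    -- choose k j` produces the factor `k + 1` that the ratio condition needs.
    rw [tsum_eq_zero_add' ENNReal.summable]
    simp only [Nat.choose_zero_succ, Nat.cast_zero, mul_zero, zero_add]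
    calc
      _ = (j.factorial : ℝ≥0∞) *
            ∑' k : ℕ, (((k + 1 : ℕ) : ℝ≥0∞) * p (k + 1)) * (k.choose j : ℝ≥0∞) := by
          rw [Nat.factorial_succ, Nat.cast_mul, mul_comm ((j + 1 : ℕ) : ℝ≥0∞), mul_assoc,
            ← ENNReal.tsum_mul_left]
          congr 1
          refine tsum_congr fun k => ?_
          have : (((k + 1 : ℕ) : ℝ≥0∞)) * (k.choose j : ℝ≥0∞) =
              ((k + 1).choose (j + 1) : ℝ≥0∞) * ((j + 1 : ℕ) : ℝ≥0∞) := by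
            exact_mod_cast Nat.add_one_mul_choose_eq k j
          calc
            _ = p (k + 1) * (((k + 1).choose (j + 1) : ℝ≥0∞) * ((j + 1 : ℕ) : ℝ≥0∞)) := by ring
            _ = _ := by rw [← this]; ring
      _ ≤ (j.factorial : ℝ≥0∞) * ∑' k : ℕ, (r * p k) * (k.choose j : ℝ≥0∞) := by
          exact mul_le_mul_right (ENNReal.tsum_le_tsum fun k => mul_le_mul_left (hp k) _) _
      _ = r * ((j.factorial : ℝ≥0∞) * ∑' k, p k * (k.choose j : ℝ≥0∞)) := by
          simp_rw [mul_assoc r, ENNReal.tsum_mul_left]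
          ring
      _ ≤ r * r ^ j := by gcongr
      _ = r ^ (j + 1) := (pow_succ' r j).symm

/-- A sequence with at most the ratios of a Poisson distribution has at most the Poisson
generating function. -/
lemma tsum_mul_one_add_pow_le {p : ℕ → ℝ≥0∞} {r w : ℝ} (hr : 0 ≤ r) (hw : 0 ≤ w)
    (hsum : ∑' k, p k ≤ 1)
    (hp : ∀ k : ℕ, ((k + 1 : ℕ) : ℝ≥0∞) * p (k + 1) ≤ ENNReal.ofReal r * p k) :
    ∑' k, p k * ENNReal.ofReal ((1 + w) ^ k) ≤ ENNReal.ofReal (Real.exp (r * w)) := by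
  have hbinom : ∀ k : ℕ, ENNReal.ofReal ((1 + w) ^ k) =
      ∑' j, ENNReal.ofReal w ^ j * (k.choose j : ℝ≥0∞) := by
    intro k
    rw [tsum_eq_sum (s := Finset.range (k + 1)), ENNReal.ofReal_pow (by positivity),
      ENNReal.ofReal_add zero_le_one hw, add_comm, add_pow]
    · simp
    · intro j hj
      rw [Nat.choose_eq_zero_of_lt (by simpa using hj)]
      simp
  calc
    _ = ∑' k, ∑' j, ENNReal.ofReal w ^ j * (p k * (k.choose j : ℝ≥0∞)) := by
        refine tsum_congr fun k => ?_
        rw [hbinom, ← ENNReal.tsum_mul_left]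
        exact tsum_congr fun j => by ring
    _ = ∑' j, ENNReal.ofReal w ^ j * ∑' k, p k * (k.choose j : ℝ≥0∞) := by
        rw [ENNReal.tsum_comm]
        exact tsum_congr fun j => ENNReal.tsum_mul_left
    _ ≤ ∑' j : ℕ, ENNReal.ofReal ((r * w) ^ j / j.factorial) := by
        refine ENNReal.tsum_le_tsum fun j => ?_
        have hj : (0 : ℝ) < j.factorial := by exact_mod_cast j.factorial_pos
        rw [ENNReal.ofReal_div_of_pos hj, ENNReal.ofReal_natCast,
          ENNReal.ofReal_pow (by positivity), ENNReal.ofReal_mul hr, mul_pow,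
          mul_comm (ENNReal.ofReal r ^ j), mul_div_assoc]
        gcongr
        rw [ENNReal.le_div_iff_mul_le (by simp [j.factorial_ne_zero]) (by simp), mul_comm]
        exact tsum_mul_choose_le hsum hp j
    _ = _ := by
        rw [← ENNReal.ofReal_tsum_of_nonneg (fun j => by positivity)
          (Real.summable_pow_div_factorial _), Real.exp_eq_exp_ℝ,
          NormedSpace.exp_eq_tsum_div]

/-- The Chernoff bound of the Poisson distribution with mean `r`, for a law on `ℕ` with at most its
ratios. -/
lemma measureReal_gt_le_of_ratio {ν : Measure ℕ} [IsProbabilityMeasure ν] {r m : ℝ} (hr : 0 < r)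
    (hm : r ≤ m)
    (hν : ∀ k : ℕ, ((k + 1 : ℕ) : ℝ≥0∞) * ν {k + 1} ≤ ENNReal.ofReal r * ν {k}) :
    ν.real {k : ℕ | m < k} ≤ Real.exp (-(m * (Real.log (m / r) - 1) + r)) := by
  have hz : 1 ≤ m / r := by rwa [one_le_div hr]
  have hz0 : 0 < m / r := by positivity
  have hsum : ∑' k, ν {k} ≤ 1 := by
    have := MeasureTheory.Measure.tsum_indicator_apply_singleton ν Set.univ MeasurableSet.univ
    simp only [Set.indicator_univ, measure_univ] at this
    exact this.le
  -- `w = m / r - 1` minimises the Chernoff bound `exp (r * w) / (1 + w) ^ m`; `r ≤ m` makes it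
  -- nonnegative.
  have hmgf := tsum_mul_one_add_pow_le hr.le (w := m / r - 1) (by linarith) hsum hν
  rw [add_sub_cancel] at hmgf
  refine ENNReal.toReal_le_of_le_ofReal (Real.exp_nonneg _) ?_
  rw [← MeasureTheory.Measure.tsum_indicator_apply_singleton ν _ (MeasurableSet.of_discrete)]
  calc
    _ ≤ ∑' k : ℕ, ENNReal.ofReal (Real.exp (-(m * Real.log (m / r)))) *
          (ν {k} * ENNReal.ofReal ((m / r) ^ k)) := by
        refine ENNReal.tsum_le_tsum fun k => ?_
        by_cases hk : m < k
        · rw [Set.indicator_of_mem (by exact hk), mul_left_comm,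
            ← ENNReal.ofReal_mul (Real.exp_nonneg _)]
          refine le_mul_of_one_le_right zero_le ?_
          rw [ENNReal.one_le_ofReal, ← Real.exp_log hz0, ← Real.exp_nat_mul, ← Real.exp_add,
            Real.exp_log hz0]
          refine Real.one_le_exp ?_
          have := mul_le_mul_of_nonneg_right hk.le (Real.log_nonneg hz)
          linarith
        · rw [Set.indicator_of_notMem (by exact hk)]
          exact zero_le
    _ ≤ ENNReal.ofReal (Real.exp (-(m * Real.log (m / r)))) *
          ENNReal.ofReal (Real.exp (r * (m / r - 1))) := by
        rw [ENNReal.tsum_mul_left]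
        gcongr
    _ = _ := by
        rw [← ENNReal.ofReal_mul (Real.exp_nonneg _), ← Real.exp_add]
        congr 2
        field_simp
        ring

/-! ### Tails of the total queue length and of the normalized projection -/

/-- Chernoff bound for the stationary total queue length. -/
lemma jsq_total_tail {n : ℕ} [NeZero n] (lam γ : ℝ) (μ : Fin n → ℝ)
    (hlam : 0 < lam) (hγ : 0 < γ) (hμ : ∀ i, 0 < μ i) {π : Measure (Fin n → ℕ)}
    (h : IsStationaryDistribution (jsqRate lam γ μ) π) {m : ℝ} (hm : lam / γ ≤ m) :
    π.real {x | m < ∑ i, (x i : ℝ)} ≤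
      Real.exp (-(m * (Real.log (m / (lam / γ)) - 1) + lam / γ)) := by
  have := h.isProbabilityMeasure
  have hmeas : Measurable fun x : Fin n → ℕ => ∑ i, x i := by fun_prop
  have : IsProbabilityMeasure (π.map fun x => ∑ i, x i) :=
    Measure.isProbabilityMeasure_map hmeas.aemeasurable
  have key := measureReal_gt_le_of_ratio (ν := π.map fun x => ∑ i, x i) (r := lam / γ)
    (by positivity) hm ?_
  · rw [map_measureReal_apply hmeas MeasurableSet.of_discrete] at key
    simpa [Set.preimage] using key
  · intro k
    rw [Measure.map_apply hmeas (measurableSet_singleton _),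
      Measure.map_apply hmeas (measurableSet_singleton _)]
    have hk := jsq_level_ratio lam γ μ hγ hμ h k
    have hγ0 : ENNReal.ofReal γ ≠ 0 := by simpa using hγ
    rw [ENNReal.ofReal_div_of_pos hγ, ← ENNReal.mul_div_right_comm,
      ENNReal.le_div_iff_mul_le (Or.inl hγ0) (Or.inl ENNReal.ofReal_ne_top), mul_comm, ← mul_assoc]
    rw [ENNReal.ofReal_mul hγ.le] at hk
    have hcast : ENNReal.ofReal ((k : ℝ) + 1) = ((k + 1 : ℕ) : ℝ≥0∞) := by
      rw [← ENNReal.ofReal_natCast]; push_cast; rfl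
    rw [hcast] at hk
    exact hk

lemma inner_onesVec {n : ℕ} (φ : EuclideanSpace ℝ (Fin n)) :
    inner ℝ φ (onesVec n) = ∑ i, φ i := by
  simp [onesVec, PiLp.inner_apply]

lemma inner_normalizedQueue {n : ℕ} (lam γ : ℝ) (μ : Fin n → ℝ) (x : Fin n → ℕ)
    (φ : EuclideanSpace ℝ (Fin n)) :
    inner ℝ (normalizedQueue lam γ μ x) φ = ((n : ℝ) * √γ / √lam) *
      (∑ i, (x i : ℝ) * φ i - (lam - ∑ i, μ i) / ((n : ℝ) * γ) * ∑ i, φ i) := by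
  rw [normalizedQueue, real_inner_smul_left, inner_sub_left, real_inner_smul_left,
    real_inner_comm _ (onesVec n), inner_onesVec]
  congr 2
  simp [PiLp.inner_apply, mul_comm]

/-- The comparison of exponents: the Poisson Chernoff exponent at `s * (b + c)` is at least the
claimed one. -/
lemma chernoff_exponent_ge {b c r s : ℝ} (hb : 0 < b) (hc : 0 ≤ c) (hcr : c ≤ r) (hr : 0 < r)
    (hs : 1 ≤ s) (hbs : Real.exp 2 * r ≤ s * b) :
    (b / 2 + c) * Real.log ((b + c) / r) ≤
      s * (b + c) * (Real.log (s * (b + c) / r) - 1) + r := by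
  have hlog : Real.log ((b + c) / r) ≤ Real.log (s * (b + c) / r) := by
    refine Real.log_le_log (by positivity) ?_
    gcongr
    nlinarith
  have htwo : 2 ≤ Real.log (s * (b + c) / r) := by
    rw [Real.le_log_iff_exp_le (by positivity), le_div_iff₀ hr]
    nlinarith
  set l := Real.log (s * (b + c) / r)
  have h1 : (b / 2 + c) * Real.log ((b + c) / r) ≤ (b / 2 + c) * l := by gcongr
  -- Right side minus `(b / 2 + c) * l` equals this product plus `(s - 1) * (b + c) + (r - c)`, and
  -- each part is nonnegative.
  have h2 : 0 ≤ (s * (b + c) - (b / 2 + c)) * (l - 2) :=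
    mul_nonneg (by nlinarith) (by linarith)
  nlinarith [mul_nonneg (sub_nonneg.2 hs) hb.le, mul_nonneg (sub_nonneg.2 hs) hc]

theorem proposition4p6 {n : ℕ} [NeZero n]
    (lam γ : ℝ) (μ : Fin n → ℝ)
    (hlam : 0 < lam) (hγ : 0 < γ) (hμ : ∀ i, 0 < μ i)
    (hover : ∑ i, μ i < lam)
    {Ω : Type*} [MeasurableSpace Ω] (P : Measure Ω) [IsProbabilityMeasure P]
    (q : Ω → Fin n → ℕ) (hq : Measurable q)
    (hstat : IsStationaryDistribution (jsqRate lam γ μ) (P.map q))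
    (φ : EuclideanSpace ℝ (Fin n)) (hφ : ‖φ‖ = 1) (hφ_nonneg : ∀ i, 0 ≤ φ i)
    (a : ℝ) (ha : Real.exp 2 * (n : ℝ) * √lam / √γ ≤ a) :
    P.real {ω | a < inner ℝ (normalizedQueue lam γ μ (q ω)) φ} ≤
      Real.exp (-((a * √lam / (2 * (n : ℝ) * √γ * inner ℝ φ (onesVec n))
            + (lam - ∑ i, μ i) / ((n : ℝ) * γ))
          * Real.log (a * √γ / ((n : ℝ) * √lam * inner ℝ φ (onesVec n))
            + (lam - ∑ i, μ i) / ((n : ℝ) * lam)))) := by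
  simp_rw [inner_normalizedQueue, inner_onesVec]
  have hn : (1 : ℝ) ≤ n := by exact_mod_cast NeZero.one_le
  have hsq : ∑ i, φ i ^ 2 = 1 := by
    have := EuclideanSpace.real_norm_sq_eq φ
    rw [hφ] at this
    linarith
  have hφ_le : ∀ i, φ i ≤ 1 := by
    intro i
    have := Finset.single_le_sum (f := fun i => φ i ^ 2) (fun j _ => sq_nonneg _)
      (Finset.mem_univ i)
    rw [hsq] at this
    nlinarith [hφ_nonneg i]
  -- Coordinates in `[0, 1]` satisfy `φ i ^ 2 ≤ φ i`.
  have hs : 1 ≤ ∑ i, φ i := by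
    rw [← hsq]
    exact Finset.sum_le_sum fun i _ => by nlinarith [hφ_nonneg i, hφ_le i]
  set s := ∑ i, φ i
  set d := lam - ∑ i, μ i with hd
  have hd0 : 0 < d := sub_pos.2 hover
  have hdlam : d ≤ lam := by linarith [Finset.sum_nonneg fun i (_ : i ∈ Finset.univ) => (hμ i).le]
  -- Naming the square roots turns the identities below into rational ones.
  obtain ⟨u, hu, hlam_eq⟩ : ∃ u : ℝ, 0 < u ∧ lam = u ^ 2 :=
    ⟨√lam, Real.sqrt_pos.2 hlam, (Real.sq_sqrt hlam.le).symm⟩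
  obtain ⟨v, hv, hγ_eq⟩ : ∃ v : ℝ, 0 < v ∧ γ = v ^ 2 :=
    ⟨√γ, Real.sqrt_pos.2 hγ, (Real.sq_sqrt hγ.le).symm⟩
  have hsu : √lam = u := by rw [hlam_eq, Real.sqrt_sq hu.le]
  have hsv : √γ = v := by rw [hγ_eq, Real.sqrt_sq hv.le]
  rw [hsu, hsv] at ha ⊢
  have ha0 : 0 < a := lt_of_lt_of_le (by positivity) ha
  have hs0 : 0 < s := by linarith
  have hn0 : (0 : ℝ) < n := by linarith
  set b := a * u / (n * v * s) with hb
  set c := d / (n * γ) with hc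
  have hb0 : 0 < b := by positivity
  have hc0 : 0 < c := by positivity
  have hcr : c ≤ lam / γ := by
    rw [hc]
    exact div_le_div₀ hlam.le hdlam hγ (by nlinarith)
  have hsb : s * b = a * u / (n * v) := by rw [hb]; field_simp
  have hbs : Real.exp 2 * (lam / γ) ≤ s * b := by
    rw [hsb]
    calc
      _ = Real.exp 2 * n * u / v * (u / (n * v)) := by
        rw [hlam_eq, hγ_eq]; field_simp
      _ ≤ a * (u / (n * v)) := by gcongr
      _ = _ := by ring
  have e1 : a * u / (2 * n * v * s) = b / 2 := by rw [hb]; field_simp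
  have e2 : a * v / (n * u * s) + d / (n * lam) = (b + c) / (lam / γ) := by
    rw [hb, hc, hlam_eq, hγ_eq]; field_simp
  rw [e1, e2]
  have hm : lam / γ ≤ s * (b + c) := by
    have h1 : (1 : ℝ) ≤ Real.exp 2 := Real.one_le_exp (by norm_num)
    have h2 : 0 < lam / γ := by positivity
    nlinarith [mul_pos hs0 hc0]
  have htail := jsq_total_tail lam γ μ hlam hγ hμ hstat hm
  rw [map_measureReal_apply hq MeasurableSet.of_discrete] at htail
  refine (measureReal_mono ?_).trans (htail.trans (Real.exp_le_exp.2 (neg_le_neg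
    (chernoff_exponent_ge hb0 hc0.le hcr (by positivity) hs hbs))))
  intro ω hω
  simp only [Set.mem_ofPred_eq, Set.mem_preimage] at hω ⊢
  -- The event with the normalization undone: dividing by `n * v / u` turns `a` into `s * b`.
  have h1 : s * b < ∑ i, (q ω i : ℝ) * φ i - c * s := by
    rw [hsb, div_lt_iff₀ (by positivity)]
    calc
      a * u < (n * v / u * (∑ i, (q ω i : ℝ) * φ i - c * s)) * u := by gcongr
      _ = _ := by field_simp
  have h2 : ∑ i, (q ω i : ℝ) * φ i ≤ ∑ i, (q ω i : ℝ) :=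
    Finset.sum_le_sum fun i _ => mul_le_of_le_one_right (Nat.cast_nonneg _) (hφ_le i)
  linarith
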